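/- There is an absolute constant $c>0$ such that the following holds for every dimension $d$. Let $f:\mathbb{R}^d\to\mathbb{R}$ be locally Lipschitz continuous, with Clarke subdifferential $$\partial f(x)=\operatorname{conv}\Big\{\lim_{k\to\infty}\nabla f(x_k)\;:\;x_k\to x,\ x_k\notin S,\ f\text{ differentiable at every }x_k\Big\},$$ where $S\subset\mathbb{R}^d$ is any fixed set of Lebesgue measure zero. Let $\alpha:\mathbb{R}^d\to[0,\infty)$ and $\beta:\mathbb{R}^d\times[0,\infty)\to[0,\infty)$ be continuous, with $\beta(x,r)$ non-decreasing in $r$, and suppose that $f$ satisfies the $(\alpha,\beta)$ subgradient growth condition, that is, $$\sup_{\zeta\in\partial f(x)}\|\zeta\|\le\alpha(x)\quad\text{and}\quad|\alpha(x)-\alpha(y)|\le\beta(x,\|y-x\|)\qquad\text{for all }x,y\in\mathbb{R}^d,$$ where $\|\cdot\|$ is the Euclidean norm. For $\delta>0$ let $f_\delta(x)=\mathbb{E}\,f(x+\delta w)$, where $w$ is uniformly distributed on the closed Euclidean unit ball of $\mathbb{R}^d$. Then $f_\delta$ is differentiable, and for all $x,y\in\mathbb{R}^d$, $$f_\delta(y)\le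 f_\delta(x)+\langle\nabla f_\delta(x),y-x\rangle+\frac{\ell(x,\|y-x\|)}{2}\,\|y-x\|^2,$$ where $$\ell(x,r)=\frac{c\sqrt d\,\big(2\alpha(x)+\beta(x,\delta)+\beta(x,r+\delta)\big)}{2\delta}.$$ -/

import Mathlib

open Filter Topology MeasureTheory

noncomputable section

/-- The Clarke subdifferential of a (locally Lipschitz) function `f` on `ℝᵈ` at `x`: the convex hull
of all limits `lim ∇f(x_k)` along sequences `x_k → x` of points at which `f` is differentiable and
which avoid `S`. Here `S` is any set of Lebesgue measure zero (for a locally Lipschitz `f` the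
choice of `S` is immaterial). -/
def clarkeSubdifferential {d : ℕ} (S : Set (EuclideanSpace ℝ (Fin d)))
    (f : EuclideanSpace ℝ (Fin d) → ℝ) (x : EuclideanSpace ℝ (Fin d)) :
    Set (EuclideanSpace ℝ (Fin d)) :=
  convexHull ℝ {ζ | ∃ u : ℕ → EuclideanSpace ℝ (Fin d),
    (∀ k, u k ∉ S ∧ DifferentiableAt ℝ f (u k)) ∧
    Tendsto u atTop (𝓝 x) ∧ Tendsto (fun k => gradient f (u k)) atTop (𝓝 ζ)}

/-- The `(α, β)` subgradient growth condition for `f : ℝᵈ → ℝ`, where `α : ℝᵈ → ℝ₊` and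
`β : ℝᵈ × ℝ₊ → ℝ₊` are continuous and `β x r` is non-decreasing in `r`. The values of `β x r` for
negative `r` play no role. The set `S` is the null set used in the Clarke subdifferential. -/
structure SubgradientGrowth {d : ℕ} (S : Set (EuclideanSpace ℝ (Fin d)))
    (f : EuclideanSpace ℝ (Fin d) → ℝ) (α : EuclideanSpace ℝ (Fin d) → ℝ)
    (β : EuclideanSpace ℝ (Fin d) → ℝ → ℝ) : Prop where
  alpha_nonneg : ∀ x, 0 ≤ α x
  alpha_continuous : Continuous α
  beta_nonneg : ∀ x r, 0 ≤ r → 0 ≤ β x r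
  beta_continuous : ContinuousOn (fun p : EuclideanSpace ℝ (Fin d) × ℝ => β p.1 p.2)
    (Set.univ ×ˢ Set.Ici 0)
  beta_monotone : ∀ x, MonotoneOn (β x) (Set.Ici 0)
  norm_subgradient_le : ∀ x, ∀ ζ ∈ clarkeSubdifferential S f x, ‖ζ‖ ≤ α x
  alpha_variation : ∀ x y, |α x - α y| ≤ β x ‖y - x‖

/-- The randomized smoothing `f_δ(x) = 𝔼 f(x + δ w)` with `w` uniformly distributed on the closed
unit ball. -/
def randomizedSmoothing {d : ℕ} (f : EuclideanSpace ℝ (Fin d) → ℝ) (δ : ℝ)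
    (x : EuclideanSpace ℝ (Fin d)) : ℝ :=
  ∫ w, f (x + δ • w)
    ∂(ProbabilityTheory.cond volume (Metric.closedBall (0 : EuclideanSpace ℝ (Fin d)) 1))

/-- `ℓ(x, r) = c √d (2 α(x) + β(x, δ) + β(x, r + δ)) / (2 δ)`. -/
def localSmoothness {d : ℕ} (c : ℝ) (α : EuclideanSpace ℝ (Fin d) → ℝ)
    (β : EuclideanSpace ℝ (Fin d) → ℝ → ℝ) (δ : ℝ) (x : EuclideanSpace ℝ (Fin d)) (r : ℝ) : ℝ :=
  c * Real.sqrt (d : ℝ) * (2 * α x + β x δ + β x (r + δ)) / (2 * δ)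

end

theorem Real.Gamma_add_half_le {x : ℝ} (hx : 0 < x) :
    Real.Gamma (x + 1 / 2) ≤ √x * Real.Gamma x := by
  have h := Real.Gamma_mul_add_mul_le_rpow_Gamma_mul_rpow_Gamma (s := x) (t := x + 1)
    (a := 1 / 2) (b := 1 / 2) hx (by linarith) (by norm_num) (by norm_num) (by norm_num)
  have hG := Real.Gamma_pos_of_pos hx
  rw [← Real.sqrt_eq_rpow, ← Real.sqrt_eq_rpow, Real.Gamma_add_one hx.ne',
    Real.sqrt_mul hx.le] at h
  calc Real.Gamma (x + 1 / 2) = Real.Gamma (1 / 2 * x + 1 / 2 * (x + 1)) := by congr 1; ring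
    _ ≤ _ := h
    _ = √x * (√(Real.Gamma x) * √(Real.Gamma x)) := by ring
    _ = _ := by rw [Real.mul_self_sqrt hG.le]

theorem volume_real_unitBall (n : ℕ) :
    volume.real (Metric.closedBall (0 : EuclideanSpace ℝ (Fin n)) 1)
      = √Real.pi ^ n / Real.Gamma (n / 2 + 1) := by
  have hG : 0 < Real.Gamma ((n : ℝ) / 2 + 1) := Real.Gamma_pos_of_pos (by positivity)
  rcases n with _ | n
  · simp [Measure.real, volume_euclideanSpace_eq_dirac]
  · rw [Measure.real, EuclideanSpace.volume_closedBall]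
    simp only [Fintype.card_fin, ENNReal.ofReal_one, one_pow, one_mul]
    exact ENNReal.toReal_ofReal (by positivity)

theorem volume_real_unitBall_le_succ (n : ℕ) :
    volume.real (Metric.closedBall (0 : EuclideanSpace ℝ (Fin n)) 1) ≤
      √((n + 1 : ℕ) : ℝ) *
        volume.real (Metric.closedBall (0 : EuclideanSpace ℝ (Fin (n + 1))) 1) := by
  have hG : 0 < Real.Gamma ((n : ℝ) / 2 + 1) := Real.Gamma_pos_of_pos (by positivity)
  have hG' : 0 < Real.Gamma (((n + 1 : ℕ) : ℝ) / 2 + 1) := Real.Gamma_pos_of_pos (by positivity)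
  have h := Real.Gamma_add_half_le (x := (n : ℝ) / 2 + 1) (by positivity)
  have h1 : √((n : ℝ) / 2 + 1) ≤ √((n + 1 : ℕ) : ℝ) * √Real.pi := by
    rw [← Real.sqrt_mul (by positivity)]
    apply Real.sqrt_le_sqrt
    push_cast
    nlinarith [Real.pi_gt_three, (Nat.cast_nonneg n : (0 : ℝ) ≤ n)]
  rw [volume_real_unitBall, volume_real_unitBall, ← mul_div_assoc, div_le_div_iff₀ hG hG', pow_succ]
  have h2 : ((n + 1 : ℕ) : ℝ) / 2 + 1 = (n : ℝ) / 2 + 1 + 1 / 2 := by push_cast; ring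
  rw [h2]
  calc √Real.pi ^ n * Real.Gamma ((n : ℝ) / 2 + 1 + 1 / 2)
      ≤ √Real.pi ^ n * ((√((n + 1 : ℕ) : ℝ) * √Real.pi) * Real.Gamma ((n : ℝ) / 2 + 1)) := by
        gcongr
        exact h.trans (by gcongr)
    _ = _ := by ring

theorem volume_unitBall_diff_single_le (n : ℕ) {t : ℝ} (ht : 0 ≤ t) :
    volume (Metric.closedBall (0 : EuclideanSpace ℝ (Fin (n + 1))) 1 \
        Metric.closedBall (EuclideanSpace.single 0 t) 1) ≤
      ENNReal.ofReal t * volume (Metric.closedBall (0 : EuclideanSpace ℝ (Fin n)) 1) := by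
  set q : (Fin n → ℝ) → ℝ := fun y => √(1 - ∑ i, y i ^ 2) with hq
  set K : Set (Fin n → ℝ) := WithLp.toLp 2 ⁻¹' Metric.closedBall (0 : EuclideanSpace ℝ (Fin n)) 1
    with hK
  set T : Set (ℝ × (Fin n → ℝ)) := {p | p.2 ∈ K ∧ -q p.2 ≤ p.1 ∧ p.1 < -q p.2 + t} with hT
  have hqm : Measurable fun p : ℝ × (Fin n → ℝ) => -q p.2 := by
    simp only [hq]; fun_prop
  have hKm : MeasurableSet K :=
    (PiLp.volume_preserving_toLp (Fin n)).measurable Metric.isClosed_closedBall.measurableSet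
  have hTm : MeasurableSet T :=
    (measurable_snd hKm).inter ((measurableSet_le hqm measurable_fst).inter
      (measurableSet_lt measurable_fst (hqm.add_const t)))
  have hφ : MeasurePreserving (fun z : EuclideanSpace ℝ (Fin (n + 1)) =>
      MeasurableEquiv.piFinSuccAbove (fun _ => ℝ) 0 (WithLp.ofLp z)) volume volume :=
    (volume_preserving_piFinSuccAbove (fun _ : Fin (n + 1) => ℝ) 0).comp
      (PiLp.volume_preserving_ofLp (Fin (n + 1)))
  have hsub : Metric.closedBall (0 : EuclideanSpace ℝ (Fin (n + 1))) 1 \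
        Metric.closedBall (EuclideanSpace.single 0 t) 1 ⊆
      (fun z : EuclideanSpace ℝ (Fin (n + 1)) =>
        MeasurableEquiv.piFinSuccAbove (fun _ => ℝ) 0 (WithLp.ofLp z)) ⁻¹' T := by
    rintro z ⟨hz1, hz2⟩
    rw [mem_closedBall_iff_norm, EuclideanSpace.norm_eq, Real.sqrt_le_one] at hz1 hz2
    simp only [Fin.sum_univ_succ, Real.norm_eq_abs, sq_abs, PiLp.sub_apply,
      sub_zero, PiLp.single_apply, if_true, Fin.succ_ne_zero, if_false, not_le] at hz1 hz2
    have hy : ∑ i : Fin n, z i.succ ^ 2 ≤ 1 := by nlinarith [sq_nonneg (z 0)]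
    have hq2 : √(1 - ∑ i : Fin n, z i.succ ^ 2) ^ 2 = 1 - ∑ i : Fin n, z i.succ ^ 2 :=
      Real.sq_sqrt (by linarith)
    have hq0 := Real.sqrt_nonneg (1 - ∑ i : Fin n, z i.succ ^ 2)
    have habs := abs_le.1 (abs_le_of_sq_le_sq (a := z 0) (by linarith) hq0)
    refine ⟨?_, ?_, ?_⟩
    · simp only [hK, Set.mem_preimage, mem_closedBall_iff_norm, EuclideanSpace.norm_eq,
        Real.sqrt_le_one]
      simpa [Fin.tail] using hy
    · simpa [hq, Fin.tail] using habs.1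
    · suffices z 0 < -√(1 - ∑ i : Fin n, z i.succ ^ 2) + t by simpa [hq, Fin.tail] using this
      by_contra! hc
      have := sq_le_sq' (a := z 0 - t)
        (b := √(1 - ∑ i : Fin n, z i.succ ^ 2)) (by linarith) (by linarith [habs.2])
      linarith
  calc _ ≤ volume _ := measure_mono hsub
    _ = volume T := hφ.measure_preimage hTm.nullMeasurableSet
    _ = ∫⁻ y, volume ((fun x => (x, y)) ⁻¹' T) := Measure.prod_apply_symm hTm
    _ ≤ ∫⁻ y, K.indicator (fun _ => ENNReal.ofReal t) y := by
        refine lintegral_mono fun y => ?_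
        by_cases hy : y ∈ K
        · have : (fun x : ℝ => (x, y)) ⁻¹' T = Set.Ico (-q y) (-q y + t) := by
            ext x; simp [hT, hy]
          simp [this, hy]
        · have : (fun x : ℝ => (x, y)) ⁻¹' T = ∅ := by
            ext x; simp [hT, hy]
          simp [this]
    _ = _ := by
        rw [lintegral_indicator_const hKm, (PiLp.volume_preserving_toLp (Fin n)).measure_preimage
          Metric.isClosed_closedBall.measurableSet.nullMeasurableSet]

theorem volume_real_unitBall_diff_le {d : ℕ} (k : EuclideanSpace ℝ (Fin d)) :
    volume.real (Metric.closedBall 0 1 \ Metric.closedBall k 1) ≤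
      ‖k‖ * (√d * volume.real (Metric.closedBall (0 : EuclideanSpace ℝ (Fin d)) 1)) := by
  rcases d with _ | n
  · simp [Subsingleton.elim k 0]
  let w : EuclideanSpace ℝ (Fin (n + 1)) := EuclideanSpace.single 0 ‖k‖
  have hw : ‖k‖ = ‖w‖ := by simp [w]
  let R := (ℝ ∙ (k - w))ᗮ.reflection
  have hR : R k = w := Submodule.reflection_sub hw
  have hpre : Metric.closedBall 0 1 \ Metric.closedBall k 1 =
      R ⁻¹' (Metric.closedBall 0 1 \ Metric.closedBall w 1) := by
    ext z
    simp only [Set.mem_sdiff, Set.mem_preimage, mem_closedBall_iff_norm, sub_zero, R.norm_map]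
    rw [← hR, ← map_sub, R.norm_map]
  have hv : volume (Metric.closedBall 0 1 \ Metric.closedBall k 1) =
      volume (Metric.closedBall 0 1 \ Metric.closedBall w 1) := by
    rw [hpre, R.measurePreserving.measure_preimage
      (measurableSet_closedBall.diff measurableSet_closedBall).nullMeasurableSet]
  calc _ = (volume (Metric.closedBall 0 1 \ Metric.closedBall w 1)).toReal := by
        rw [Measure.real, hv]
    _ ≤ (ENNReal.ofReal ‖k‖ * volume (Metric.closedBall (0 : EuclideanSpace ℝ (Fin n)) 1)).toReal :=
        ENNReal.toReal_mono (ENNReal.mul_ne_top ENNReal.ofReal_ne_top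
          measure_closedBall_lt_top.ne) (volume_unitBall_diff_single_le n (norm_nonneg k))
    _ = ‖k‖ * volume.real (Metric.closedBall (0 : EuclideanSpace ℝ (Fin n)) 1) := by
        rw [ENNReal.toReal_mul, ENNReal.toReal_ofReal (norm_nonneg k), Measure.real]
    _ ≤ _ := by gcongr; exact volume_real_unitBall_le_succ n

theorem LocallyLipschitz.exists_lipschitzOnWith_closedBall {d : ℕ}
    {f : EuclideanSpace ℝ (Fin d) → ℝ} (hf : LocallyLipschitz f)
    (x : EuclideanSpace ℝ (Fin d)) (r : ℝ) :
    ∃ K, LipschitzOnWith K f (Metric.closedBall x r) :=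
  hf.locallyLipschitzOn.exists_lipschitzOnWith_of_compact (isCompact_closedBall x r)

/-- **Rademacher's theorem** for locally Lipschitz functions. -/
theorem LocallyLipschitz.ae_differentiableAt {d : ℕ} {f : EuclideanSpace ℝ (Fin d) → ℝ}
    (hf : LocallyLipschitz f) : ∀ᵐ z, DifferentiableAt ℝ f z := by
  have h : ∀ n : ℕ, ∀ᵐ z : EuclideanSpace ℝ (Fin d), z ∈ Metric.closedBall 0 (n : ℝ) →
      DifferentiableWithinAt ℝ f (Metric.closedBall 0 n) z := fun n => by
    obtain ⟨K, hK⟩ := hf.exists_lipschitzOnWith_closedBall 0 n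
    exact hK.ae_differentiableWithinAt_of_mem
  filter_upwards [ae_all_iff.2 h] with z hz
  obtain ⟨n, hn⟩ := exists_nat_gt ‖z‖
  have hzn : z ∈ Metric.ball (0 : EuclideanSpace ℝ (Fin d)) n := by simpa using hn
  exact (hz n (Metric.ball_subset_closedBall hzn)).differentiableAt
    (mem_of_superset (Metric.isOpen_ball.mem_nhds hzn) Metric.ball_subset_closedBall)

theorem SubgradientGrowth.norm_fderiv_le {d : ℕ} {S : Set (EuclideanSpace ℝ (Fin d))}
    {f α : EuclideanSpace ℝ (Fin d) → ℝ} {β : EuclideanSpace ℝ (Fin d) → ℝ → ℝ}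
    (h : SubgradientGrowth S f α β) {z : EuclideanSpace ℝ (Fin d)} (hz : z ∉ S)
    (hd : DifferentiableAt ℝ f z) : ‖fderiv ℝ f z‖ ≤ α z := by
  have := h.norm_subgradient_le z (gradient f z) (subset_convexHull ℝ _
    ⟨fun _ => z, fun _ => ⟨hz, hd⟩, tendsto_const_nhds, tendsto_const_nhds⟩)
  rwa [gradient, LinearIsometryEquiv.norm_map] at this

theorem SubgradientGrowth.alpha_le {d : ℕ} {S : Set (EuclideanSpace ℝ (Fin d))}
    {f α : EuclideanSpace ℝ (Fin d) → ℝ} {β : EuclideanSpace ℝ (Fin d) → ℝ → ℝ}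
    (h : SubgradientGrowth S f α β) {x z : EuclideanSpace ℝ (Fin d)} {r : ℝ}
    (hr : ‖z - x‖ ≤ r) : α z ≤ α x + β x r := by
  have h1 := (abs_le.1 (h.alpha_variation x z)).1
  have h2 := h.beta_monotone x (norm_nonneg (z - x)) ((norm_nonneg _).trans hr) hr
  linarith

theorem quasiMeasurePreserving_add_smul {d : ℕ} (x : EuclideanSpace ℝ (Fin d)) {δ : ℝ}
    (hδ : δ ≠ 0) : Measure.QuasiMeasurePreserving (fun w => x + δ • w) volume volume :=
  (measurePreserving_add_left volume x).quasiMeasurePreserving.comp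
    (Measure.quasiMeasurePreserving_smul volume hδ)

theorem hasFDerivAt_randomizedSmoothing {d : ℕ} {f : EuclideanSpace ℝ (Fin d) → ℝ}
    (hf : LocallyLipschitz f) {δ : ℝ} (hδ : 0 < δ) (x : EuclideanSpace ℝ (Fin d)) :
    Integrable (fun w => fderiv ℝ f (x + δ • w))
      (ProbabilityTheory.cond volume (Metric.closedBall (0 : EuclideanSpace ℝ (Fin d)) 1)) ∧
    HasFDerivAt (randomizedSmoothing f δ) (∫ w, fderiv ℝ f (x + δ • w)
      ∂(ProbabilityTheory.cond volume (Metric.closedBall (0 : EuclideanSpace ℝ (Fin d)) 1))) x := by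
  obtain ⟨K, hK⟩ := hf.exists_lipschitzOnWith_closedBall x (1 + δ)
  have hmeas : ∀ y, Continuous fun w => f (y + δ • w) := fun y =>
    hf.continuous.comp (by fun_prop)
  have hmem := ProbabilityTheory.ae_cond_mem (μ := volume)
    (measurableSet_closedBall (x := (0 : EuclideanSpace ℝ (Fin d))) (ε := 1))
  have hmaps : ∀ w ∈ Metric.closedBall (0 : EuclideanSpace ℝ (Fin d)) 1,
      ∀ y ∈ Metric.closedBall x 1, y + δ • w ∈ Metric.closedBall x (1 + δ) := by
    intro w hw y hy
    rw [mem_closedBall_iff_norm] at hw hy ⊢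
    rw [sub_zero] at hw
    calc ‖y + δ • w - x‖ = ‖(y - x) + δ • w‖ := by congr 1; abel
      _ ≤ ‖y - x‖ + ‖δ • w‖ := norm_add_le _ _
      _ ≤ 1 + δ * 1 := by
        rw [norm_smul, Real.norm_of_nonneg hδ.le]; gcongr
      _ = _ := by ring
  refine hasFDerivAt_integral_of_dominated_loc_of_lip (F := fun y w => f (y + δ • w))
    (bound := fun _ => (K : ℝ)) (Metric.closedBall_mem_nhds x one_pos)
    (Eventually.of_forall fun y => (hmeas y).aestronglyMeasurable) ?_
    ((measurable_fderiv ℝ f).comp (by fun_prop)).aestronglyMeasurable ?_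
    (integrable_const _) ?_
  · obtain ⟨C, hC⟩ := (isCompact_closedBall (0 : EuclideanSpace ℝ (Fin d)) 1).exists_bound_of_continuousOn
      (hmeas x).continuousOn
    exact Integrable.of_bound (hmeas x).aestronglyMeasurable C (hmem.mono fun w hw => hC w hw)
  · filter_upwards [hmem] with w hw
    rw [Real.nnabs_coe]
    intro y hy z hz
    simpa [edist_add_right] using hK (hmaps w hw y hy) (hmaps w hw z hz)
  · have h := (quasiMeasurePreserving_add_smul x hδ.ne').ae hf.ae_differentiableAt
    filter_upwards [ProbabilityTheory.cond_absolutelyContinuous.ae_le h] with w hw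
    exact (hasFDerivAt_comp_add_right (δ • w)).2 hw.hasFDerivAt

theorem abs_setIntegral_sub_setIntegral_le {X : Type*} [MeasurableSpace X] {μ : Measure X}
    {A B : Set X} {g : X → ℝ} {a b : ℝ} (hA : MeasurableSet A) (hB : MeasurableSet B)
    (hμA : μ A < ⊤) (hμB : μ B < ⊤) (hg : AEStronglyMeasurable g μ)
    (ha : ∀ᵐ x ∂μ, x ∈ A → ‖g x‖ ≤ a) (hb : ∀ᵐ x ∂μ, x ∈ B → ‖g x‖ ≤ b) :
    |(∫ x in A, g x ∂μ) - ∫ x in B, g x ∂μ| ≤ a * μ.real (A \ B) + b * μ.real (B \ A) := by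
  have hgA : IntegrableOn g A μ := IntegrableOn.of_bound hμA hg.restrict a
    ((ae_restrict_iff' hA).2 ha)
  have hgB : IntegrableOn g B μ := IntegrableOn.of_bound hμB hg.restrict b
    ((ae_restrict_iff' hB).2 hb)
  rw [← integral_inter_add_sdiff hB hgA, ← integral_inter_add_sdiff hA hgB, Set.inter_comm B A,
    add_sub_add_left_eq_sub]
  refine (abs_sub _ _).trans (add_le_add ?_ ?_)
  · exact norm_setIntegral_le_of_norm_le_const_ae' ((measure_mono Set.sdiff_subset).trans_lt hμA)
      (ha.mono fun x hx h => hx h.1)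
  · exact norm_setIntegral_le_of_norm_le_const_ae' ((measure_mono Set.sdiff_subset).trans_lt hμB)
      (hb.mono fun x hx h => hx h.1)

theorem volume_real_diff_unitBall_le {d : ℕ} (k : EuclideanSpace ℝ (Fin d)) :
    volume.real (Metric.closedBall k 1 \ Metric.closedBall 0 1) ≤
      ‖k‖ * (√d * volume.real (Metric.closedBall (0 : EuclideanSpace ℝ (Fin d)) 1)) := by
  have h := volume_real_unitBall_diff_le (-k)
  have hpre : Metric.closedBall 0 1 \ Metric.closedBall (-k) 1 =
      (fun w => w + k) ⁻¹' (Metric.closedBall k 1 \ Metric.closedBall 0 1) := by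
    ext z; simp
  rwa [hpre, norm_neg, Measure.real, (measurePreserving_add_right volume k).measure_preimage
      (measurableSet_closedBall.diff measurableSet_closedBall).nullMeasurableSet] at h

theorem integral_cond_unitBall_add {d : ℕ} (g : EuclideanSpace ℝ (Fin d) → ℝ)
    (k : EuclideanSpace ℝ (Fin d)) :
    ∫ w, g (w + k)
        ∂(ProbabilityTheory.cond volume (Metric.closedBall (0 : EuclideanSpace ℝ (Fin d)) 1)) =
      (volume.real (Metric.closedBall (0 : EuclideanSpace ℝ (Fin d)) 1))⁻¹ *
        ∫ w in Metric.closedBall k 1, g w := by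
  have hpre : Metric.closedBall 0 1 = (fun w => w + k) ⁻¹' (Metric.closedBall k 1) := by
    ext z; simp
  rw [ProbabilityTheory.cond, integral_smul_measure, ENNReal.toReal_inv, smul_eq_mul]
  congr 1
  conv_lhs => rw [hpre]
  exact (measurePreserving_add_right volume k).setIntegral_preimage_emb
    (measurableEmbedding_addRight k) g _

theorem SubgradientGrowth.fderiv_randomizedSmoothing_sub_le {d : ℕ}
    {S : Set (EuclideanSpace ℝ (Fin d))} (hS : volume S = 0)
    {f α : EuclideanSpace ℝ (Fin d) → ℝ} {β : EuclideanSpace ℝ (Fin d) → ℝ → ℝ}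
    (hf : LocallyLipschitz f) (h : SubgradientGrowth S f α β) {δ : ℝ} (hδ : 0 < δ)
    (x u v : EuclideanSpace ℝ (Fin d)) :
    fderiv ℝ (randomizedSmoothing f δ) (x + u) v - fderiv ℝ (randomizedSmoothing f δ) x v ≤
      √d * (2 * α x + β x δ + β x (‖u‖ + δ)) / δ * ‖u‖ * ‖v‖ := by
  obtain ⟨hi, hd⟩ := hasFDerivAt_randomizedSmoothing hf hδ x
  obtain ⟨hi', hd'⟩ := hasFDerivAt_randomizedSmoothing hf hδ (x + u)
  set V := volume.real (Metric.closedBall (0 : EuclideanSpace ℝ (Fin d)) 1) with hVdef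
  have hV : 0 < V := ENNReal.toReal_pos
    (Metric.measure_closedBall_pos volume _ one_pos).ne' measure_closedBall_lt_top.ne
  set g : EuclideanSpace ℝ (Fin d) → ℝ := fun w => fderiv ℝ f (x + δ • w) v with hg
  set k := δ⁻¹ • u with hk
  have hku : δ • k = u := by rw [hk, smul_inv_smul₀ hδ.ne']
  have hknorm : ‖k‖ = ‖u‖ / δ := by
    rw [hk, norm_smul, norm_inv, Real.norm_of_nonneg hδ.le, inv_mul_eq_div]
  have hgm : AEStronglyMeasurable g volume :=
    ((measurable_fderiv_apply_const ℝ f v).comp (by fun_prop)).aestronglyMeasurable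
  have hgbound : ∀ᵐ w, ∀ r, ‖δ • w‖ ≤ r → ‖g w‖ ≤ (α x + β x r) * ‖v‖ := by
    have hSae : ∀ᵐ z : EuclideanSpace ℝ (Fin d), z ∉ S := measure_eq_zero_iff_ae_notMem.1 hS
    filter_upwards [(quasiMeasurePreserving_add_smul x hδ.ne').ae
      (hSae.and hf.ae_differentiableAt)] with w hw r hr
    refine (ContinuousLinearMap.le_opNorm _ _).trans ?_
    gcongr
    exact (h.norm_fderiv_le hw.1 hw.2).trans (h.alpha_le (by simpa using hr))
  rw [hd.fderiv, hd'.fderiv, ContinuousLinearMap.integral_apply hi,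
    ContinuousLinearMap.integral_apply hi']
  have e1 := integral_cond_unitBall_add g k
  have e0 := integral_cond_unitBall_add g 0
  simp only [hg, smul_add, hku, add_zero] at e1 e0
  have e2 : ∀ w, x + u + δ • w = x + (δ • w + u) := fun w => by abel
  simp only [e2]
  rw [e1, e0, ← mul_sub]
  have key := abs_setIntegral_sub_setIntegral_le (μ := volume) (g := g)
    (A := Metric.closedBall k 1) (B := Metric.closedBall 0 1)
    (a := (α x + β x (‖u‖ + δ)) * ‖v‖) (b := (α x + β x δ) * ‖v‖)
    measurableSet_closedBall measurableSet_closedBall measure_closedBall_lt_top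
    measure_closedBall_lt_top hgm
    (hgbound.mono fun w hw hwk => hw _ <| by
      rw [mem_closedBall_iff_norm] at hwk
      calc ‖δ • w‖ = ‖u + δ • (w - k)‖ := by rw [smul_sub, hku]; congr 1; abel
        _ ≤ ‖u‖ + ‖δ • (w - k)‖ := norm_add_le _ _
        _ ≤ ‖u‖ + δ * 1 := by rw [norm_smul, Real.norm_of_nonneg hδ.le]; gcongr
        _ = _ := by ring)
    (hgbound.mono fun w hw hw0 => hw _ <| by
      rw [mem_closedBall_iff_norm, sub_zero] at hw0
      rw [norm_smul, Real.norm_of_nonneg hδ.le]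
      exact mul_le_of_le_one_right hδ.le hw0)
  have ha : 0 ≤ α x + β x (‖u‖ + δ) :=
    add_nonneg (h.alpha_nonneg x) (h.beta_nonneg x _ (by positivity))
  have hb : 0 ≤ α x + β x δ := add_nonneg (h.alpha_nonneg x) (h.beta_nonneg x _ hδ.le)
  calc V⁻¹ * ((∫ w in Metric.closedBall k 1, g w) - ∫ w in Metric.closedBall 0 1, g w)
      ≤ V⁻¹ * ((α x + β x (‖u‖ + δ)) * ‖v‖ * (‖k‖ * (√d * V)) +
          (α x + β x δ) * ‖v‖ * (‖k‖ * (√d * V))) := by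
        gcongr
        refine (le_abs_self _).trans (key.trans ?_)
        gcongr
        · exact volume_real_diff_unitBall_le k
        · exact volume_real_unitBall_diff_le k
    _ = _ := by rw [hknorm]; field_simp; ring

/-- The quadratic upper bound obtained by integrating a one-sided Lipschitz bound on the
derivative along a segment. -/
theorem le_add_fderiv_add_sq_of_fderiv_sub_le {E : Type*} [NormedAddCommGroup E]
    [NormedSpace ℝ E] {F : E → ℝ} (hF : Differentiable ℝ F) {x v : E} {C : ℝ}
    (h : ∀ t ∈ Set.Icc (0 : ℝ) 1, fderiv ℝ F (x + t • v) v - fderiv ℝ F x v ≤ C * t) :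
    F (x + v) ≤ F x + fderiv ℝ F x v + C / 2 := by
  have hφ : ∀ t : ℝ, HasDerivAt (fun t : ℝ => F (x + t • v)) (fderiv ℝ F (x + t • v) v) t :=
    fun t => by
      have := (hF (x + t • v)).hasFDerivAt.comp_hasDerivAt t
        (((hasDerivAt_id t).smul_const v).const_add x)
      simpa [Function.comp_def] using this
  have hB : ∀ t : ℝ, HasDerivAt (fun t : ℝ => F x + fderiv ℝ F x v * t + C / 2 * t ^ 2)
      (fderiv ℝ F x v + C * t) t := fun t => by
    have := (((hasDerivAt_id t).const_mul (fderiv ℝ F x v)).const_add (F x)).add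
      (((hasDerivAt_id t).pow 2).const_mul (C / 2))
    refine this.congr_deriv ?_
    simp only [id]; ring
  have := image_le_of_deriv_right_le_deriv_boundary (a := 0) (b := 1)
    (fun t _ => (hφ t).continuousAt.continuousWithinAt) (fun t _ => (hφ t).hasDerivWithinAt)
    (by simp) (fun t _ => (hB t).continuousAt.continuousWithinAt)
    (fun t _ => (hB t).hasDerivWithinAt)
    (fun t ht => by linarith [h t ⟨ht.1, ht.2.le⟩]) (Set.right_mem_Icc.2 zero_le_one)
  simpa using this

theorem mainTheorem8 :
    ∃ c : ℝ, 0 < c ∧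
      ∀ (d : ℕ) (S : Set (EuclideanSpace ℝ (Fin d))), volume S = 0 →
      ∀ (f : EuclideanSpace ℝ (Fin d) → ℝ) (α : EuclideanSpace ℝ (Fin d) → ℝ)
        (β : EuclideanSpace ℝ (Fin d) → ℝ → ℝ),
      LocallyLipschitz f → SubgradientGrowth S f α β →
      ∀ δ : ℝ, 0 < δ →
        Differentiable ℝ (randomizedSmoothing f δ) ∧
        ∀ x y : EuclideanSpace ℝ (Fin d),
          randomizedSmoothing f δ y ≤ randomizedSmoothing f δ x
            + inner ℝ (gradient (randomizedSmoothing f δ) x) (y - x)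
            + localSmoothness c α β δ x ‖y - x‖ / 2 * ‖y - x‖ ^ 2 := by
  refine ⟨2, two_pos, fun d S hS f α β hf h δ hδ => ?_⟩
  have hdiff : Differentiable ℝ (randomizedSmoothing f δ) := fun x =>
    (hasFDerivAt_randomizedSmoothing hf hδ x).2.differentiableAt
  refine ⟨hdiff, fun x y => ?_⟩
  have key := le_add_fderiv_add_sq_of_fderiv_sub_le hdiff (x := x) (v := y - x)
    (C := localSmoothness 2 α β δ x ‖y - x‖ * ‖y - x‖ ^ 2) fun t ht => by
      refine (h.fderiv_randomizedSmoothing_sub_le hS hf hδ x (t • (y - x)) (y - x)).trans ?_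
      have hn : ‖t • (y - x)‖ = t * ‖y - x‖ := by rw [norm_smul, Real.norm_of_nonneg ht.1]
      have ht0 : 0 ≤ t := ht.1
      have hβ : β x (t * ‖y - x‖ + δ) ≤ β x (‖y - x‖ + δ) :=
        h.beta_monotone x (Set.mem_Ici.2 (by positivity)) (Set.mem_Ici.2 (by positivity))
          (by gcongr; exact mul_le_of_le_one_left (norm_nonneg _) ht.2)
      rw [hn, localSmoothness]
      calc √d * (2 * α x + β x δ + β x (t * ‖y - x‖ + δ)) / δ * (t * ‖y - x‖) * ‖y - x‖
          ≤ √d * (2 * α x + β x δ + β x (‖y - x‖ + δ)) / δ * (t * ‖y - x‖) * ‖y - x‖ := by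
            gcongr
        _ = _ := by field_simp
  rw [add_sub_cancel] at key
  rw [inner_gradient_left]
  linarith
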